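/- A right congruence on a semigroup $S$ is an equivalence relation $\rho$ on $S$ such that $a\mathrel{\rho}b$ implies $ac\mathrel{\rho}bc$ for all $a,b,c\in S$; it is finitely generated if it is the smallest right congruence containing some finite set $X\subseteq S\times S$. A semigroup is right noetherian if every right congruence on it is finitely generated, and a group is called noetherian if it is right noetherian. Theorem. Let $M$ and $N$ be two monoids. Then the monoid free product of $M$ and $N$ (their coproduct in the category of monoids) is right noetherian if and only if one of the following holds: 1. $M$ is right noetherian and $N$ is trivial, or $N$ is right noetherian and $M$ is trivial; 2. both $M$ and $N$ contain precisely two elements. In particular, the free product of two non-trivial groups $G$ and $H$ is noetherian if and only if both $G$ and $H$ are isomorphic to $\mathbb{Z}_2$, the cyclic group of order two. -/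

import Mathlib

universe u v

/-- A right congruence on `S`: an equivalence relation compatible with multiplication on the
right. -/
structure IsRightCongruence {S : Type u} [Mul S] (r : S → S → Prop) : Prop where
  equivalence : Equivalence r
  mul_right : ∀ a b c : S, r a b → r (a * c) (b * c)

/-- `r` is the right congruence generated by `X`, i.e. the smallest right congruence
containing every pair of `X`. -/
structure IsRightCongruenceGeneratedBy {S : Type u} [Mul S] (r : S → S → Prop)
    (X : Set (S × S)) : Prop where
  isRightCongruence : IsRightCongruence r
  contains : ∀ p ∈ X, r p.1 p.2
  minimal : ∀ t : S → S → Prop, IsRightCongruence t → (∀ p ∈ X, t p.1 p.2) →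
    ∀ a b : S, r a b → t a b

/-- `S` is right noetherian if every right congruence on `S` is finitely generated. -/
def IsRightNoetherian (S : Type u) [Mul S] : Prop :=
  ∀ r : S → S → Prop, IsRightCongruence r →
    ∃ X : Set (S × S), X.Finite ∧ IsRightCongruenceGeneratedBy r X

/-! If one factor is trivial, the free product is the other factor. If both have two elements, it
consists of alternating words in two letters, each an involution or an idempotent. A right
congruence there is determined by which words reduce to earlier ones; these are closed under
prolongation, so one relation for each of the two starting letters generates it
(`IsRightNoetherian.of_enumeration`).

Otherwise, up to symmetry, there are distinct `c`, `d` ≠ 1 in `M` and `b` ≠ 1 in `N`. With `w i = (c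
* b) ^ i * d`, no pair `(w n * b, w n)` follows from the others: `Monoid.Coprod.exists_pointed_act`
gives acts separating just one of them. This yields a strictly ascending chain of right congruences.
-/

/-- Right noetherianity passes to homomorphic images. -/
theorem IsRightNoetherian.of_surjective {S : Type u} {T : Type v} [Mul S] [Mul T]
    (h : IsRightNoetherian S) (f : S →ₙ* T) (hf : Function.Surjective f) :
    IsRightNoetherian T := by
  intro r hr
  have hr' : IsRightCongruence fun a b : S => r (f a) (f b) :=
    { equivalence := ⟨fun _ => hr.equivalence.refl _, fun h => hr.equivalence.symm h,
        fun h₁ h₂ => hr.equivalence.trans h₁ h₂⟩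
      mul_right := fun a b c hab => by
        simpa only [map_mul] using hr.mul_right _ _ (f c) hab }
  obtain ⟨X, hX, hgen⟩ := h _ hr'
  refine ⟨Prod.map f f '' X, hX.image _, hr, ?_, ?_⟩
  · rintro _ ⟨p, hp, rfl⟩
    exact hgen.contains p hp
  · intro t ht htX a b hab
    obtain ⟨a, rfl⟩ := hf a
    obtain ⟨b, rfl⟩ := hf b
    refine hgen.minimal (fun a b => t (f a) (f b)) ⟨⟨fun _ => ht.equivalence.refl _,
      fun h => ht.equivalence.symm h, fun h₁ h₂ => ht.equivalence.trans h₁ h₂⟩, ?_⟩ ?_ a b hab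
    · intro a b c hab
      simpa only [map_mul] using ht.mul_right _ _ (f c) hab
    · intro p hp
      exact htX _ ⟨p, hp, rfl⟩

/-- In a right noetherian semigroup every ascending sequence of right congruences stabilises. -/
theorem IsRightNoetherian.exists_stable {S : Type u} [Mul S] (h : IsRightNoetherian S)
    (r : ℕ → S → S → Prop) (hr : ∀ n, IsRightCongruence (r n))
    (hmono : ∀ m n, m ≤ n → ∀ a b, r m a b → r n a b) :
    ∃ n, ∀ m a b, r m a b → r n a b := by
  have hU : IsRightCongruence fun a b => ∃ n, r n a b :=
    { equivalence := ⟨fun _ => ⟨0, (hr 0).equivalence.refl _⟩,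
        fun ⟨n, hn⟩ => ⟨n, (hr n).equivalence.symm hn⟩,
        fun ⟨m, hm⟩ ⟨n, hn⟩ => ⟨max m n, (hr _).equivalence.trans
          (hmono _ _ (le_max_left m n) _ _ hm) (hmono _ _ (le_max_right m n) _ _ hn)⟩⟩
      mul_right := fun a b c ⟨n, hn⟩ => ⟨n, (hr n).mul_right _ _ _ hn⟩ }
  obtain ⟨X, hX, hgen⟩ := h _ hU
  have hbound : ∃ n, ∀ p ∈ X, r n p.1 p.2 := by
    have hcon : ∀ p : X, ∃ n, r n p.1.1 p.1.2 := fun p => hgen.contains _ p.2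
    choose k hk using hcon
    have := hX.to_subtype
    obtain ⟨n, hn⟩ := (Set.finite_range k).bddAbove
    exact ⟨n, fun p hp => hmono _ _ (hn ⟨⟨p, hp⟩, rfl⟩) _ _ (hk ⟨p, hp⟩)⟩
  obtain ⟨n, hn⟩ := hbound
  exact ⟨n, fun m a b hab => hgen.minimal _ (hr n) hn a b ⟨m, hab⟩⟩

/-! ### Normal forms for alternating words -/

/-- A semigroup enumerated so that appending a suitable factor shifts the enumeration by two,
while moving every earlier element by less, is right noetherian. -/
theorem IsRightNoetherian.of_enumeration {S : Type u} [Mul S] (g : ℕ → S)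
    (hg : Function.Surjective g)
    (hstep : ∀ n, 1 ≤ n → ∃ c, g (n + 2) = g n * c ∧ ∀ m < n, ∃ k < n + 2, g m * c = g k) :
    IsRightNoetherian S := by
  intro r hr
  -- `P n` says that `g n` is reducible. It propagates from `n` to `n + 2`, so the set `A` of its
  -- minimal places has at most one element of each parity.
  let P : ℕ → Prop := fun n => ∃ m < n, r (g n) (g m)
  have hPstep : ∀ n, P n → P (n + 2) := by
    rintro n ⟨m, hmn, hrm⟩
    obtain ⟨c, hc, hlt⟩ := hstep n (by omega)
    obtain ⟨k, hk, hmk⟩ := hlt m hmn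
    exact ⟨k, hk, by simpa only [hc, hmk] using hr.mul_right _ _ c hrm⟩
  have hPadd : ∀ n k, P n → P (n + 2 * k) := by
    intro n k hn
    induction k with
    | zero => exact hn
    | succ k ih => exact hPstep _ ih
  let A : Set ℕ := {n | P n ∧ ¬ (2 ≤ n ∧ P (n - 2))}
  have hAlt : ∀ m ∈ A, ∀ n ∈ A, m % 2 = n % 2 → n ≤ m := by
    rintro m ⟨hm, -⟩ n ⟨-, hn⟩ hmn
    by_contra! hlt
    refine hn ⟨by omega, ?_⟩
    have := hPadd m ((n - 2 - m) / 2) hm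
    rwa [show m + 2 * ((n - 2 - m) / 2) = n - 2 by omega] at this
  have hA : A.Finite := by
    refine Set.Finite.of_finite_image (f := fun n => n % 2)
      ((Set.finite_lt_nat 2).subset ?_) ?_
    · rintro _ ⟨n, -, rfl⟩
      exact Nat.mod_lt _ two_pos
    · exact fun m hm n hn hmn => le_antisymm (hAlt n hn m hm hmn.symm) (hAlt m hm n hn hmn)
  have hw : ∀ n : ℕ, ∃ m, P n → m < n ∧ r (g n) (g m) := by
    intro n
    by_cases hn : P n
    · exact ⟨hn.choose, fun _ => hn.choose_spec⟩
    · exact ⟨0, fun h => absurd h hn⟩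
  choose w hw using hw
  refine ⟨(fun n => (g n, g (w n))) '' A, hA.image _, hr, ?_, ?_⟩
  · rintro _ ⟨n, hn, rfl⟩
    exact (hw n hn.1).2
  · intro t ht htX
    have hred : ∀ n, P n → ∃ m < n, t (g n) (g m) ∧ r (g n) (g m) := by
      intro n
      induction n using Nat.strong_induction_on with
      | _ n ih =>
        intro hn
        by_cases hnA : 2 ≤ n ∧ P (n - 2)
        · obtain ⟨j, rfl⟩ := Nat.exists_eq_add_of_le' hnA.1
          obtain ⟨m, hm, htm, hrm⟩ := ih j (by omega) hnA.2
          obtain ⟨c, hc, hlt⟩ := hstep j (by omega)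
          obtain ⟨k, hk, hmk⟩ := hlt m hm
          rw [hc]
          exact ⟨k, hk, hmk ▸ ht.mul_right _ _ c htm, hmk ▸ hr.mul_right _ _ c hrm⟩
        · exact ⟨w n, (hw n hn).1, htX _ ⟨n, ⟨hn, hnA⟩, rfl⟩, (hw n hn).2⟩
    -- Distinct irreducible elements are never `r`-related, so reducing both sides by `t` proves `r
    -- ≤ t`.
    have hnf : ∀ n, ∃ m, ¬ P m ∧ t (g n) (g m) ∧ r (g n) (g m) := by
      intro n
      induction n using Nat.strong_induction_on with
      | _ n ih =>
        by_cases hn : P n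
        · obtain ⟨m, hm, htm, hrm⟩ := hred n hn
          obtain ⟨k, hk, htk, hrk⟩ := ih m hm
          exact ⟨k, hk, ht.equivalence.trans htm htk, hr.equivalence.trans hrm hrk⟩
        · exact ⟨n, hn, ht.equivalence.refl _, hr.equivalence.refl _⟩
    intro x y hxy
    obtain ⟨i, rfl⟩ := hg x
    obtain ⟨j, rfl⟩ := hg y
    obtain ⟨i', hi', hti, hri⟩ := hnf i
    obtain ⟨j', hj', htj, hrj⟩ := hnf j
    have hij : r (g i') (g j') :=
      hr.equivalence.trans (hr.equivalence.symm hri) (hr.equivalence.trans hxy hrj)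
    have heq : i' = j' := by
      rcases lt_trichotomy i' j' with hlt | heq | hlt
      · exact absurd ⟨i', hlt, hr.equivalence.symm hij⟩ hj'
      · exact heq
      · exact absurd ⟨j', hlt, hij⟩ hi'
    subst heq
    exact ht.equivalence.trans hti (ht.equivalence.symm htj)

/-- Letter by which the `n`-th alternating word in `a` and `b` is prolonged. -/
def altLetter {S : Type u} (a b : S) (n : ℕ) : S :=
  if n % 4 = 0 ∨ n % 4 = 1 then b else a

/-- The alternating words in `a` and `b`, in the order `1, a, b, ab, ba, aba, bab, …`. -/
def altWord {S : Type u} [Monoid S] (a b : S) : ℕ → S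
  | 0 => 1
  | 1 => a
  | 2 => b
  | n + 3 => altWord a b (n + 1) * altLetter a b (n + 1)

/-- A letter either prolongs the word, moving it at most two places on, or meets its own copy and is
cancelled or absorbed. -/
theorem altWord_mul {S : Type u} [Monoid S] {a b : S} (ha : a * a = 1 ∨ a * a = a)
    (hb : b * b = 1 ∨ b * b = b) {x : S} (hx : x = a ∨ x = b) (n : ℕ) :
    ∃ m ≤ n + 2, altWord a b n * x = altWord a b m := by
  have hxx : x * x = 1 ∨ x * x = x := by rcases hx with rfl | rfl <;> assumption
  match n with
  | 0 =>
    rcases hx with rfl | rfl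
    · exact ⟨1, by omega, by simp [altWord]⟩
    · exact ⟨2, by omega, by simp [altWord]⟩
  | 1 =>
    rcases hx with rfl | rfl
    · rcases ha with h | h
      · exact ⟨0, by omega, by simp [altWord, h]⟩
      · exact ⟨1, by omega, by simp [altWord, h]⟩
    · exact ⟨3, by omega, by simp [altWord, altLetter]⟩
  | 2 =>
    rcases hx with rfl | rfl
    · exact ⟨4, by omega, by simp [altWord, altLetter]⟩
    · rcases hb with h | h
      · exact ⟨0, by omega, by simp [altWord, h]⟩
      · exact ⟨2, by omega, by simp [altWord, h]⟩
  | n + 3 =>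
    have hor : x = altLetter a b (n + 3) ∨ x = altLetter a b (n + 1) := by
      have h4 : n % 4 = 0 ∨ n % 4 = 1 ∨ n % 4 = 2 ∨ n % 4 = 3 := by omega
      rcases h4 with h | h | h | h <;> rcases hx with rfl | rfl <;>
        simp [altLetter, Nat.add_mod, h]
    rcases hor with h | h
    · exact ⟨n + 5, by omega, by rw [h]; rfl⟩
    · rcases hxx with h' | h'
      · exact ⟨n + 1, by omega, by rw [altWord, ← h, mul_assoc, h', mul_one]⟩
      · exact ⟨n + 3, by omega, by rw [altWord, ← h, mul_assoc, h']⟩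

/-- A monoid generated by two elements, each an involution or an idempotent, is right
noetherian. -/
theorem IsRightNoetherian.of_closure_pair {S : Type u} [Monoid S] {a b : S}
    (ha : a * a = 1 ∨ a * a = a) (hb : b * b = 1 ∨ b * b = b)
    (hab : Submonoid.closure {a, b} = ⊤) : IsRightNoetherian S := by
  refine .of_enumeration (altWord a b) (fun s => ?_) fun n hn => ?_
  · have hs : s ∈ Submonoid.closure {a, b} := hab ▸ Submonoid.mem_top s
    induction hs using Submonoid.closure_induction_right with
    | one => exact ⟨0, rfl⟩
    | mul_right x _ y hy ih =>
      obtain ⟨n, rfl⟩ := ih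
      obtain ⟨m, -, hm⟩ := altWord_mul ha hb hy n
      exact ⟨m, hm.symm⟩
  · obtain ⟨n, rfl⟩ := Nat.exists_eq_add_of_le' hn
    refine ⟨altLetter a b (n + 1), rfl, fun m hm => ?_⟩
    have hx : altLetter a b (n + 1) = a ∨ altLetter a b (n + 1) = b := by
      unfold altLetter; split_ifs <;> simp
    obtain ⟨k, hk, h⟩ := altWord_mul ha hb hx m
    exact ⟨k, by omega, h⟩

/-! ### Acts separating one pair -/

/-- A disjoint family of copies of the regular right act inside a set extends to a right action
fixing all other points. -/
theorem exists_rightAction_of_injective {M : Type u} [Monoid M] {I Ω : Type*} (e : I × M → Ω)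
    (he : Function.Injective e) :
    ∃ φ : M →* (Function.End Ω)ᵐᵒᵖ, (∀ i x m, (φ m).unop (e (i, x)) = e (i, x * m)) ∧
      ∀ ω ∉ Set.range e, ∀ m, (φ m).unop ω = ω := by
  classical
  let f : M → Ω → Ω := fun m ω =>
    if h : ω ∈ Set.range e then e (h.choose.1, h.choose.2 * m) else ω
  have hf : ∀ i x m, f m (e (i, x)) = e (i, x * m) := by
    intro i x m
    have h : e (i, x) ∈ Set.range e := ⟨_, rfl⟩
    have h' : h.choose = (i, x) := he h.choose_spec
    simp only [f, dif_pos h, h']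
  have hf' : ∀ ω ∉ Set.range e, ∀ m, f m ω = ω := fun ω h m => dif_neg h
  refine ⟨⟨⟨fun m => MulOpposite.op (f m), ?_⟩, ?_⟩, hf, hf'⟩
  · refine MulOpposite.unop_injective (funext fun ω => ?_)
    change f 1 ω = ω
    by_cases h : ω ∈ Set.range e
    · obtain ⟨⟨i, x⟩, rfl⟩ := h
      rw [hf, mul_one]
    · exact hf' ω h 1
  · intro m m'
    refine MulOpposite.unop_injective (funext fun ω => ?_)
    change f (m * m') ω = f m' (f m ω)
    by_cases h : ω ∈ Set.range e
    · obtain ⟨⟨i, x⟩, rfl⟩ := h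
      rw [hf, hf, hf, mul_assoc]
    · rw [hf' ω h, hf' ω h, hf' ω h]

/-- A pointed right act of the free product in which `N` fixes the images of the base point under
`(c * b) ^ i * d`, except for `i = n`. -/
theorem Monoid.Coprod.exists_pointed_act {M : Type u} {N : Type v} [Monoid M] [Monoid N]
    {c d : M} {b : N} (hc : c ≠ 1) (hd : d ≠ 1) (hcd : c ≠ d) (hb : b ≠ 1) (n : ℕ) :
    ∃ (Ω : Type (max u v)) (φ : Monoid.Coprod M N →* (Function.End Ω)ᵐᵒᵖ) (ω : Ω),
      ∀ i, (φ ((inl c * inr b) ^ i * inl d * inr b)).unop ω =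
        (φ ((inl c * inr b) ^ i * inl d)).unop ω ↔ i ≠ n := by
  classical
  -- Copies of `N` are glued to copies of `M` so that `b` sends `(j, c)` to `(j + 1, 1)`. The copy
  -- indexed by `none` starts at `(n, d)`, which `b` therefore moves; every other `(i, d)` lies
  -- outside the range and is fixed.
  let e : Option ℕ × N → (ℕ × M) ⊕ (Option ℕ × N) := fun p => match p with
    | (none, x) => if x = 1 then .inl (n, d) else .inr (none, x)
    | (some j, x) => if x = 1 then .inl (j, c) else if x = b then .inl (j + 1, 1)
        else .inr (some j, x)
  have he : Function.Injective e := by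
    rintro ⟨_ | j, x⟩ ⟨_ | k, y⟩ h <;> simp only [e] at h <;> split_ifs at h <;> simp_all
  have hfix : ∀ i, i ≠ n → Sum.inl (i, d) ∉ Set.range e := by
    rintro i hi ⟨⟨_ | j, x⟩, h⟩ <;> simp only [e] at h <;> split_ifs at h <;> simp_all
  obtain ⟨α, hα, -⟩ := exists_rightAction_of_injective
    (Sum.inl : ℕ × M → (ℕ × M) ⊕ (Option ℕ × N)) Sum.inl_injective
  obtain ⟨β, hβ, hβ'⟩ := exists_rightAction_of_injective e he
  let φ := Monoid.Coprod.lift α β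
  have hmul : ∀ s t ω, (φ (s * t)).unop ω = (φ t).unop ((φ s).unop ω) := fun s t ω => by
    rw [map_mul]; rfl
  have hl : ∀ m, φ (inl m) = α m := fun m => Monoid.Coprod.lift_apply_inl α β m
  have hr : ∀ x, φ (inr x) = β x := fun x => Monoid.Coprod.lift_apply_inr α β x
  have hbase : ∀ i, (φ ((inl c * inr b) ^ i)).unop (Sum.inl (0, 1)) = Sum.inl (i, 1) := by
    intro i
    induction i with
    | zero => rw [pow_zero, map_one]; rfl
    | succ i ih =>
      have h1 : Sum.inl (i, c) = e (some i, 1) := by simp [e]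
      rw [pow_succ, hmul, ih, hmul, hl, hr, hα, one_mul, h1]
      refine (hβ (some i) 1 b).trans ?_
      simp [e, hb]
  refine ⟨_, φ, Sum.inl (0, 1), fun i => ?_⟩
  rw [hmul, hmul, hbase, hl, hr, hα, one_mul]
  constructor
  · rintro h rfl
    have h1 : Sum.inl (i, d) = e (none, 1) := by simp [e]
    rw [h1] at h
    have h2 : ((none : Option ℕ), 1 * b) = (none, 1) := he ((hβ none 1 b).symm.trans h)
    simp [hb] at h2
  · intro hi
    exact hβ' _ (hfix i hi) b

theorem Monoid.Coprod.not_isRightNoetherian {M : Type u} {N : Type v} [Monoid M] [Monoid N]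
    {c d : M} {b : N} (hc : c ≠ 1) (hd : d ≠ 1) (hcd : c ≠ d) (hb : b ≠ 1) :
    ¬ IsRightNoetherian (Monoid.Coprod M N) := by
  intro h
  choose Ω φ ω hφ using Monoid.Coprod.exists_pointed_act hc hd hcd hb
  -- The `n`-th congruence is agreement at the base points of all acts `m ≥ n`; passing to `n + 1`
  -- drops the act separating the `n`-th pair.
  obtain ⟨n, hn⟩ := h.exists_stable
    (fun n s t => ∀ m, n ≤ m → (φ m s).unop (ω m) = (φ m t).unop (ω m))
    (fun n => ⟨⟨fun _ _ _ => rfl, fun h m hm => (h m hm).symm,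
      fun h h' m hm => (h m hm).trans (h' m hm)⟩, fun s t x h m hm => by
        have hmul : ∀ s, (φ m (s * x)).unop (ω m) = (φ m x).unop ((φ m s).unop (ω m)) :=
          fun s => by rw [map_mul]; rfl
        rw [hmul, hmul, h m hm]⟩)
    (fun m n hmn s t h k hk => h k (hmn.trans hk))
  exact (hφ n n).1 (hn (n + 1) _ _ (fun m hm => (hφ m n).2 (by omega)) n le_rfl) rfl

/-! ### Classification by cardinality -/

theorem exists_two_ne_one_of_card_ne_two {M : Type u} [Monoid M] [Nontrivial M]
    (h : Nat.card M ≠ 2) : ∃ c d : M, c ≠ 1 ∧ d ≠ 1 ∧ c ≠ d := by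
  obtain ⟨c, hc⟩ := exists_ne (1 : M)
  by_contra! hcon
  refine h (Nat.card_eq_two_iff.2 ⟨c, 1, hc, Set.eq_univ_of_forall fun d => ?_⟩)
  by_cases hd : d = 1
  · exact Or.inr hd
  · exact Or.inl (hcon c d hc hd).symm

theorem exists_forall_eq_of_card_eq_two {M : Type u} [Monoid M] (h : Nat.card M = 2) :
    ∃ a : M, ∀ x, x = 1 ∨ x = a := by
  obtain ⟨a, b, -, hab⟩ := Nat.card_eq_two_iff.1 h
  have hmem : ∀ x : M, x = a ∨ x = b := fun x => by
    have : x ∈ ({a, b} : Set M) := hab ▸ Set.mem_univ x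
    simpa using this
  rcases hmem 1 with h1 | h1
  · exact ⟨b, fun x => h1 ▸ hmem x⟩
  · exact ⟨a, fun x => h1 ▸ (hmem x).symm⟩

theorem Monoid.Coprod.isRightNoetherian_of_card_eq_two {M : Type u} {N : Type v} [Monoid M]
    [Monoid N] (hM : Nat.card M = 2) (hN : Nat.card N = 2) :
    IsRightNoetherian (Monoid.Coprod M N) := by
  obtain ⟨a, ha⟩ := exists_forall_eq_of_card_eq_two hM
  obtain ⟨b, hb⟩ := exists_forall_eq_of_card_eq_two hN
  refine .of_closure_pair (a := inl a) (b := inr b) ?_ ?_ ?_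
  · rw [← map_mul]
    exact (ha (a * a)).imp (fun h => by rw [h, map_one]) fun h => by rw [h]
  · rw [← map_mul]
    exact (hb (b * b)).imp (fun h => by rw [h, map_one]) fun h => by rw [h]
  · refine eq_top_iff.2 fun s _ => ?_
    induction s using Monoid.Coprod.induction_on with
    | inl m =>
      rcases ha m with rfl | rfl
      · rw [map_one]; exact one_mem _
      · exact Submonoid.subset_closure (by simp)
    | inr m =>
      rcases hb m with rfl | rfl
      · rw [map_one]; exact one_mem _
      · exact Submonoid.subset_closure (by simp)
    | mul x y hx hy => exact mul_mem (hx trivial) (hy trivial)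

theorem Monoid.Coprod.inl_surjective_of_subsingleton {M : Type u} {N : Type v} [Monoid M]
    [Monoid N] [Subsingleton N] :
    Function.Surjective (inl : M →* Monoid.Coprod M N) := by
  intro s
  induction s using Monoid.Coprod.induction_on with
  | inl m => exact ⟨m, rfl⟩
  | inr x => exact ⟨1, by rw [Subsingleton.elim x 1, map_one, map_one]⟩
  | mul x y hx hy =>
    obtain ⟨x, rfl⟩ := hx
    obtain ⟨y, rfl⟩ := hy
    exact ⟨x * y, map_mul _ _ _⟩

theorem Monoid.Coprod.isRightNoetherian_iff_of_subsingleton {M : Type u} {N : Type v} [Monoid M]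
    [Monoid N] [Subsingleton N] :
    IsRightNoetherian (Monoid.Coprod M N) ↔ IsRightNoetherian M :=
  ⟨fun h => h.of_surjective (fst : Monoid.Coprod M N →* M).toMulHom fst_surjective,
    fun h => h.of_surjective (inl : M →* Monoid.Coprod M N).toMulHom
      inl_surjective_of_subsingleton⟩

theorem Monoid.Coprod.isRightNoetherian_swap {M : Type u} {N : Type v} [Monoid M] [Monoid N]
    (h : IsRightNoetherian (Monoid.Coprod M N)) : IsRightNoetherian (Monoid.Coprod N M) :=
  h.of_surjective (MulEquiv.coprodComm M N).toMulHom (MulEquiv.coprodComm M N).surjective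

theorem Monoid.Coprod.isRightNoetherian_iff {M : Type u} {N : Type v} [Monoid M] [Monoid N] :
    IsRightNoetherian (Monoid.Coprod M N) ↔
      ((IsRightNoetherian M ∧ Subsingleton N) ∨ (Subsingleton M ∧ IsRightNoetherian N)) ∨
        (Nat.card M = 2 ∧ Nat.card N = 2) := by
  constructor
  · intro h
    rcases subsingleton_or_nontrivial N with hN | hN
    · exact .inl (.inl ⟨isRightNoetherian_iff_of_subsingleton.1 h, hN⟩)
    rcases subsingleton_or_nontrivial M with hM | hM
    · exact .inl (.inr ⟨hM, isRightNoetherian_iff_of_subsingleton.1 (isRightNoetherian_swap h)⟩)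
    refine .inr ⟨?_, ?_⟩ <;> by_contra hcard <;>
      obtain ⟨c, d, hc, hd, hcd⟩ := exists_two_ne_one_of_card_ne_two hcard
    · obtain ⟨b, hb⟩ := exists_ne (1 : N)
      exact not_isRightNoetherian hc hd hcd hb h
    · obtain ⟨b, hb⟩ := exists_ne (1 : M)
      exact not_isRightNoetherian hc hd hcd hb (isRightNoetherian_swap h)
  · rintro ((⟨h, hN⟩ | ⟨hM, h⟩) | ⟨hM, hN⟩)
    · exact isRightNoetherian_iff_of_subsingleton.2 h
    · exact isRightNoetherian_swap (isRightNoetherian_iff_of_subsingleton.2 h)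
    · exact isRightNoetherian_of_card_eq_two hM hN

theorem card_eq_two_iff_nonempty_mulEquiv {G : Type u} [Group G] :
    Nat.card G = 2 ↔ Nonempty (G ≃* Multiplicative (ZMod 2)) := by
  have h2 : Nat.card (Multiplicative (ZMod 2)) = 2 := by
    rw [Nat.card_congr Multiplicative.toAdd, Nat.card_zmod]
  have : Fact (Nat.Prime 2) := ⟨Nat.prime_two⟩
  exact ⟨fun h => ⟨mulEquivOfPrimeCardEq h h2⟩, fun ⟨f⟩ => (Nat.card_congr f.toEquiv).trans h2⟩

theorem mainTheorem4 :
    (∀ (M : Type u) (N : Type v) [Monoid M] [Monoid N],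
      IsRightNoetherian (Monoid.Coprod M N) ↔
        ((IsRightNoetherian M ∧ Subsingleton N) ∨ (Subsingleton M ∧ IsRightNoetherian N)) ∨
          (Nat.card M = 2 ∧ Nat.card N = 2)) ∧
    (∀ (G : Type u) (H : Type v) [Group G] [Group H] [Nontrivial G] [Nontrivial H],
      IsRightNoetherian (Monoid.Coprod G H) ↔
        Nonempty (G ≃* Multiplicative (ZMod 2)) ∧ Nonempty (H ≃* Multiplicative (ZMod 2))) := by
  refine ⟨fun M N _ _ => Monoid.Coprod.isRightNoetherian_iff, fun G H _ _ _ _ => ?_⟩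
  rw [Monoid.Coprod.isRightNoetherian_iff, ← card_eq_two_iff_nonempty_mulEquiv,
    ← card_eq_two_iff_nonempty_mulEquiv]
  simp [not_subsingleton]
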